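/- **Setting.** Let $Y$ be a modular or Shimura curve over $\mathbb C$: a smooth algebraic curve with a uniformization $u:\mathbb H\to Y(\mathbb C)$ identifying $Y(\mathbb C)$ with $\Gamma\backslash\mathbb H$, where $\Gamma\subset \mathrm{SL}_2(\mathbb R)$ is commensurable with the group of norm-one units of an order in an indefinite quaternion algebra $D$ over $\mathbb Q$ (embedded in $M_2(\mathbb R)$; $D\cong M_2(\mathbb Q)$ for modular curves, $D$ a division algebra for Shimura curves). Let $E$ be an elliptic curve over $\mathbb C$, and let $V\subset Y\times E$ be an irreducible correspondence, i.e. an irreducible closed algebraic curve dominating $Y$. Let $n\ge 0$. Subvarieties are irreducible and closed. *Special subvarieties.* The special subvarieties of $E^n$ are the cosets of abelian subvarieties by torsion points. The special subvarieties of $Y^n$ are the images under $u$ of the loci in $\mathbb H^n$ defined by setting some coordinates equal to CM points (points of $\mathbb H$ fixed by a non-scalar element of $D$ of positive norm) and relating some other coordinates by elements of $D$ of positive norm. The special subvarieties of $Y^n\times E^n$ are the products $S\times B$ with $S\subset Y^n$ and $B\subset E^n$ special. For a subvariety $Z\subset Y^n\times E^n$ let $\langle Z\rangle$ be the smallest special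 subvariety containing $Z$, and let $\delta(Z)=\dim\langle Z\rangle-\dim Z$ be its defect. A subvariety $A\subset Z$ is an *optimal subvariety* of $Z$ if every subvariety $C$ with $A\subset C\subset Z$ and $\delta(C)\le\delta(A)$ equals $A$. *Special graphs.* Let $\pi_{Y^n},\pi_{E^n}$ be the projections of $Y^n\times E^n$. A *special graph* in $V^n$ is an irreducible component $W$ of $V^n\cap(S\times B)$, with $S\subset Y^n$ and $B\subset E^n$ special, such that $\pi_{Y^n}(W)=S$ and $\pi_{E^n}(W)\subset B$. It is *exemplary* if, with $B$ the smallest special subvariety of $E^n$ containing $\pi_{E^n}(W)$, there is no special graph $W'\supsetneq W$ in $V^n$ with $\pi_{E^n}(W')\subset B$. **Proposition 2.2.** Every exemplary special graph in $V^n$ is an optimal subvariety of $V^n$. Consequently, if the Zilber–Pink conjecture holds for $Y^n\times E^n$ (every subvariety $Z\subset Y^n\times E^n$ has only finitely many optimal subvarieties), then there are only finitely many exemplary special graphs in $V^n$. -/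

import Mathlib

open CategoryTheory Limits AlgebraicGeometry
open scoped MonoidalCategory CartesianMonoidalCategory MonObj UpperHalfPlane MatrixGroups

noncomputable section

namespace SpecialGraphs

/-! ### Varieties over `ℂ` and their complex points

A variety is a scheme over `Spec ℂ`; its subvarieties are the irreducible closed subsets of the
underlying (Zariski) topological space. -/

/-- Schemes over `Spec ℂ`. -/
abbrev SchC : Type 1 := Over (Spec (.of ℂ))

/-- The complex points of `X`, i.e. the sections of `X ⟶ Spec ℂ`. -/
abbrev Pts (X : SchC) : Type := 𝟙_ SchC ⟶ X

/-- The closed point of the underlying space of `X` that belongs to a complex point. -/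
def pt {X : SchC} (x : Pts X) : X.left := x.left (IsLocalRing.closedPoint ℂ)

/-- The value at the complex point `x` of a regular function `f` on the open set `U`
(and `0` when `x` does not lie in `U`). -/
def evalAt {X : SchC} (U : X.left.Opens) (f : Γ(X.left, U)) (x : Pts X) : ℂ :=
  open Classical in
  if h : (⊤ : (𝟙_ SchC).left.Opens) ≤ x.left ⁻¹ᵁ U then
    (Scheme.ΓSpecIso (.of ℂ)).hom (x.left.appLE U ⊤ h f)
  else 0

/-- The power `X ^ n` over `ℂ`. -/
abbrev power (X : SchC) (n : ℕ) : SchC := ∏ᶜ fun _ : Fin n => X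

/-- The complex point of `X ^ n` with coordinates `x i`. -/
def tuple {X : SchC} {n : ℕ} (x : Fin n → Pts X) : Pts (power X n) := Pi.lift x

/-- An irreducible closed subset. -/
def IsSubvariety {X : Type} [TopologicalSpace X] (A : Set X) : Prop :=
  IsClosed A ∧ IsIrreducible A

/-- `A` is an irreducible component of the set `Z`. -/
def IsComponentOf {X : Type} [TopologicalSpace X] (A Z : Set X) : Prop :=
  Maximal (fun C => IsSubvariety C ∧ C ⊆ Z) A

/-- The Krull dimension of a subset, as an integer (all dimensions below are finite, and
the sets nonempty). -/
def dim {X : Type} [TopologicalSpace X] (A : Set X) : ℤ :=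
  ((topologicalKrullDim A).unbotD 0).toNat

/-! ### Modular and Shimura curves -/

/-- `D` is an indefinite quaternion algebra over `ℚ`, given with a splitting over `ℝ`: a
four-dimensional `ℚ`-subalgebra of `M₂(ℝ)` that spans `M₂(ℝ)` over `ℝ`, so that
`ℝ ⊗ D ≅ M₂(ℝ)`. -/
structure IsIndefiniteQuaternionAlgebra
    (D : Subalgebra ℚ (Matrix (Fin 2) (Fin 2) ℝ)) : Prop where
  finrank_eq : Module.finrank ℚ D = 4
  span_eq : Submodule.span ℝ (D : Set (Matrix (Fin 2) (Fin 2) ℝ)) = ⊤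

/-- `O` is an order of `D`: a subring that is finitely generated over `ℤ` and spans `D` over `ℚ`. -/
structure IsOrderOf (D : Subalgebra ℚ (Matrix (Fin 2) (Fin 2) ℝ))
    (O : Subring (Matrix (Fin 2) (Fin 2) ℝ)) : Prop where
  fg : O.toAddSubgroup.FG
  span_eq : Submodule.span ℚ (O : Set (Matrix (Fin 2) (Fin 2) ℝ)) = Subalgebra.toSubmodule D

/-- The group of units of reduced norm one of `O`. -/
def normOneUnits (O : Subring (Matrix (Fin 2) (Fin 2) ℝ)) : Subgroup SL(2, ℝ) where
  carrier := {g | (g : Matrix (Fin 2) (Fin 2) ℝ) ∈ O ∧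
    ((g⁻¹ : SL(2, ℝ)) : Matrix (Fin 2) (Fin 2) ℝ) ∈ O}
  mul_mem' := by
    rintro a b ⟨ha, ha'⟩ ⟨hb, hb'⟩
    refine ⟨?_, ?_⟩
    · rw [Matrix.SpecialLinearGroup.coe_mul]
      exact O.mul_mem ha hb
    · rw [mul_inv_rev, Matrix.SpecialLinearGroup.coe_mul]
      exact O.mul_mem hb' ha'
  one_mem' := by
    refine ⟨?_, ?_⟩
    · rw [Matrix.SpecialLinearGroup.coe_one]
      exact O.one_mem
    · rw [inv_one, Matrix.SpecialLinearGroup.coe_one]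
      exact O.one_mem
  inv_mem' := by
    rintro a ⟨ha, ha'⟩
    exact ⟨ha', by rwa [inv_inv]⟩

/-- A modular curve (`algebra` is a matrix algebra over `ℚ`) or a Shimura curve (`algebra` is a
division algebra): a smooth algebraic curve over `ℂ` together with the uniformization
`unif : ℍ → curve(ℂ)` that identifies its complex points with the Riemann surface `group \ ℍ`, where
`group` is commensurable with the norm one units of an order of `algebra`. -/
structure ShimuraCurve where
  curve : SchC
  isIntegral : IsIntegral curve.left
  isSeparated : IsSeparated curve.hom
  locallyOfFiniteType : LocallyOfFiniteType curve.hom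
  quasiCompact : QuasiCompact curve.hom
  smooth : Smooth curve.hom
  dim_eq_one : topologicalKrullDim curve.left = 1
  algebra : Subalgebra ℚ (Matrix (Fin 2) (Fin 2) ℝ)
  isIndefinite : IsIndefiniteQuaternionAlgebra algebra
  group : Subgroup SL(2, ℝ)
  isArithmetic : ∃ O : Subring (Matrix (Fin 2) (Fin 2) ℝ),
    IsOrderOf algebra O ∧ Subgroup.Commensurable group (normOneUnits O)
  unif : ℍ → Pts curve
  unif_surjective : Function.Surjective unif
  unif_eq_iff : ∀ z w : ℍ, unif z = unif w ↔ ∃ g ∈ group, g • z = w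
  isOpen_preimage : ∀ U : curve.left.Opens, IsOpen {z : ℍ | pt (unif z) ∈ U}
  unif_holomorphic : ∀ (U : curve.left.Opens) (f : Γ(curve.left, U)),
    DifferentiableOn ℂ (fun z : ℂ => evalAt U f (unif (UpperHalfPlane.ofComplex z)))
      {z : ℂ | 0 < z.im ∧ pt (unif (UpperHalfPlane.ofComplex z)) ∈ U}

/-- `g` has positive determinant and belongs to the quaternion algebra `D`. -/
def IsRational (D : Subalgebra ℚ (Matrix (Fin 2) (Fin 2) ℝ)) (g : GL (Fin 2) ℝ) : Prop :=
  (g : Matrix (Fin 2) (Fin 2) ℝ) ∈ D ∧ 0 < (g : Matrix (Fin 2) (Fin 2) ℝ).det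

/-- The points of `ℍ` over the special (CM) points of the curve: those fixed by a non-scalar
element of the quaternion algebra. -/
def IsCMPoint (D : Subalgebra ℚ (Matrix (Fin 2) (Fin 2) ℝ)) (z : ℍ) : Prop :=
  ∃ g : GL (Fin 2) ℝ, IsRational D g ∧
    (∀ c : ℝ, (g : Matrix (Fin 2) (Fin 2) ℝ) ≠ Matrix.scalar (Fin 2) c) ∧ g • z = z

/-- One coordinate of a special locus in `ℍ ^ n`: either a constant, or `g • w j` for a parameter
`w j`. -/
def coordinate {k : ℕ} (w : Fin k → ℍ) : ℍ ⊕ (Fin k × GL (Fin 2) ℝ) → ℍ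
  | .inl τ => τ
  | .inr (j, g) => g • w j

/-- The constants are CM points and the matrices come from the quaternion algebra. -/
def IsSpecialCoordinate (D : Subalgebra ℚ (Matrix (Fin 2) (Fin 2) ℝ)) {k : ℕ} :
    ℍ ⊕ (Fin k × GL (Fin 2) ℝ) → Prop
  | .inl τ => IsCMPoint D τ
  | .inr (_, g) => IsRational D g

/-- Special subvarieties of `Y ^ n`: those subvarieties whose set of complex points is the image of
a locus in `ℍ ^ n` given by setting some coordinates equal to CM points and relating
other coordinates by elements of positive norm of the quaternion algebra. -/
def IsSpecialY (Y : ShimuraCurve) (n : ℕ) (S : Set (power Y.curve n).left) : Prop :=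
  IsSubvariety S ∧ ∃ (k : ℕ) (a : Fin n → ℍ ⊕ (Fin k × GL (Fin 2) ℝ)),
    (∀ i, IsSpecialCoordinate Y.algebra (a i)) ∧
    {x : Fin n → Pts Y.curve | pt (tuple x) ∈ S} =
      Set.range fun w : Fin k → ℍ => fun i => Y.unif (coordinate w (a i))

/-! ### Elliptic curves -/

/-- An elliptic curve over `ℂ`: a one-dimensional integral proper group scheme over `ℂ`
(such a group scheme is automatically smooth and commutative). -/
structure IsEllipticCurve (E : SchC) [GrpObj E] : Prop where
  isIntegral : IsIntegral E.left
  isProper : IsProper E.hom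
  dim_eq_one : topologicalKrullDim E.left = 1

/-- Special subvarieties of `E ^ n`, i.e. torsion cosets: the subvarieties whose complex
points form a coset, by a torsion point, of a subgroup of `E(ℂ) ^ n`. (That subgroup is then the
group of complex points of an irreducible closed subgroup, i.e. of an abelian subvariety.) -/
def IsSpecialE (E : SchC) [GrpObj E] (n : ℕ) (B : Set (power E n).left) : Prop :=
  IsSubvariety B ∧ ∃ (H : Subgroup (Fin n → Pts E)) (t : Fin n → Pts E),
    IsOfFinOrder t ∧
    {x : Fin n → Pts E | pt (tuple x) ∈ B} = (fun h => t * h) '' (H : Set (Fin n → Pts E))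

/-! ### The ambient variety `Y ^ n × E ^ n` -/

section Ambient

variable (Y : ShimuraCurve) (E : SchC) (n : ℕ)

/-- `Y ^ n × E ^ n`. -/
abbrev ambient : SchC := power Y.curve n ⊗ power E n

/-- The projection to `Y ^ n`. -/
def projY : (ambient Y E n).left → (power Y.curve n).left :=
  (CartesianMonoidalCategory.fst (power Y.curve n) (power E n)).left

/-- The projection to `E ^ n`. -/
def projE : (ambient Y E n).left → (power E n).left :=
  (CartesianMonoidalCategory.snd (power Y.curve n) (power E n)).left

/-- The projection of `Y ^ n × E ^ n` to the `i`-th copy of `Y × E`. -/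
def projPair (i : Fin n) : (ambient Y E n).left → (Y.curve ⊗ E).left :=
  (CartesianMonoidalCategory.lift
    (CartesianMonoidalCategory.fst (power Y.curve n) (power E n) ≫ Pi.π (fun _ => Y.curve) i)
    (CartesianMonoidalCategory.snd (power Y.curve n) (power E n) ≫ Pi.π (fun _ => E) i)).left

variable {Y E n} in
/-- The subset `S × B` of `Y ^ n × E ^ n`. -/
def prodSet (S : Set (power Y.curve n).left) (B : Set (power E n).left) :
    Set (ambient Y E n).left :=
  projY Y E n ⁻¹' S ∩ projE Y E n ⁻¹' B

/-- Special subvarieties of `Y ^ n × E ^ n`: products of special subvarieties. -/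
def IsSpecial [GrpObj E] (T : Set (ambient Y E n).left) : Prop :=
  ∃ S B, IsSpecialY Y n S ∧ IsSpecialE E n B ∧ T = prodSet S B

/-- `⟨Z⟩`, the smallest special subvariety that contains the subvariety `Z`. (The conventional
value is the whole space if there is none, which does not happen for a subvariety.) -/
def specialHull [GrpObj E] (Z : Set (ambient Y E n).left) : Set (ambient Y E n).left :=
  open Classical in
  if h : ∃ T, IsLeast {T | IsSpecial Y E n T ∧ Z ⊆ T} T then h.choose else Set.univ

/-- The defect `δ(Z) = dim ⟨Z⟩ - dim Z`. -/
def defect [GrpObj E] (Z : Set (ambient Y E n).left) : ℤ :=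
  dim (specialHull Y E n Z) - dim Z

/-- `A` is an optimal subvariety of `Z`: a subvariety contained in `Z`, and maximal for its defect
among these. -/
def IsOptimal [GrpObj E] (Z A : Set (ambient Y E n).left) : Prop :=
  IsSubvariety A ∧ A ⊆ Z ∧
    ∀ C : Set (ambient Y E n).left, IsSubvariety C → A ⊆ C → C ⊆ Z → defect Y E n C ≤ defect Y E n A → C = A

/-- The Zilber–Pink conjecture for `Y ^ n × E ^ n`: every subvariety has only finitely many
optimal subvarieties. -/
def ZilberPink [GrpObj E] : Prop :=
  ∀ Z : Set (ambient Y E n).left, IsSubvariety Z → {A : Set (ambient Y E n).left | IsOptimal Y E n Z A}.Finite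

end Ambient

/-! ### Special graphs -/

section Graphs

variable (Y : ShimuraCurve) (E : SchC)

/-- `V ⊆ Y × E` is an irreducible correspondence: an irreducible closed curve that dominates `Y`.
(Dominance over `E`, often part of the definition too, is not required.) -/
structure IsCorrespondence (V : Set (Y.curve ⊗ E).left) : Prop where
  isSubvariety : IsSubvariety V
  dim_eq_one : topologicalKrullDim V = 1
  dominant : Dense ((CartesianMonoidalCategory.fst Y.curve E).left '' V)

variable {Y E} (V : Set (Y.curve ⊗ E).left) (n : ℕ)

/-- `V ^ n`, as a subset of `Y ^ n × E ^ n`. -/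
def powerSet : Set (ambient Y E n).left :=
  {p | ∀ i, projPair Y E n i p ∈ V}

/-- Special graphs in `V ^ n`. -/
def IsSpecialGraph [GrpObj E] (W : Set (ambient Y E n).left) : Prop :=
  ∃ S B, IsSpecialY Y n S ∧ IsSpecialE E n B ∧
    IsComponentOf W (powerSet V n ∩ prodSet S B) ∧
    projY Y E n '' W = S ∧ projE Y E n '' W ⊆ B

/-- Exemplary special graphs in `V ^ n`. -/
def IsExemplary [GrpObj E] (W : Set (ambient Y E n).left) : Prop :=
  IsSpecialGraph V n W ∧
    ∃ B, IsLeast {B | IsSpecialE E n B ∧ projE Y E n '' W ⊆ B} B ∧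
      ¬ ∃ W', IsSpecialGraph V n W' ∧ W ⊂ W' ∧ projE Y E n '' W' ⊆ B

end Graphs

end SpecialGraphs

end

/-! The geometric input is that `V → Y` is finite: it is proper because `E` is, and it has finite
fibres because it is a dominant map from an irreducible curve to a curve. Hence `Vⁿ → Yⁿ` is finite,
and every closed `C ⊆ Vⁿ` has the same dimension as its closed image in `Yⁿ`
(`topologicalKrullDim_projY_image`).

The rest is a dimension count. Let `W` be exemplary, with image `S` in `Yⁿ` and with `B` the
smallest torsion coset containing its image in `Eⁿ`. Then `⟨W⟩ = S × B` and `dim W = dim S`, so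
`δ(W) = dim B`. If `W ⊆ C ⊆ Vⁿ` and `⟨C⟩ = S' × B'`, then `dim C ≤ dim S'` and `B ⊆ B'`, so `δ(C) ≥
dim B' ≥ dim B`. When `δ(C) ≤ δ(W)`, all these are equalities: `B' = B`, `C` maps onto `S'`, and `C`
is a component of `Vⁿ ∩ (S' × B)`. So `C` is a special graph over `B`, and exemplarity forces `C =
W`.

The count needs `dim (S × B) = dim S + dim B`, obtained from Noether normalization
(`topologicalKrullDim_pullback`). The finiteness statement needs `Vⁿ` to be irreducible
(`isSubvariety_powerSet`). -/

open CategoryTheory Limits AlgebraicGeometry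
open scoped MonoidalCategory CartesianMonoidalCategory MonObj UpperHalfPlane MatrixGroups

/-! ### Krull dimension of spaces under closed maps, inclusions and open covers. -/

section Topology

open TopologicalSpace Order

variable {X Z : Type*} [TopologicalSpace X] [TopologicalSpace Z]

/-- Taking images is strictly monotone on irreducible closed sets: if `A ⊆ B` have the same image,
the generic point of `B` shares its image with one of its specializations in `A`, hence equals it.
-/
theorem topologicalKrullDim_le_of_specializes_eq [QuasiSober Z] {φ : Z → X} (hφ : Continuous φ)
    (hc : IsClosedMap φ) (hs : ∀ p q, p ⤳ q → φ p = φ q → p = q) :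
    topologicalKrullDim Z ≤ topologicalKrullDim X := by
  refine krullDim_le_of_strictMono (IrreducibleCloseds.map φ hφ) fun A B hAB => ?_
  have hle : (A : Set Z) ⊆ B := hAB.le
  refine lt_of_le_of_ne ?_ fun h => hAB.not_ge ?_
  · exact closure_mono (Set.image_mono hle)
  · obtain ⟨b, hb⟩ := QuasiSober.sober B.isIrreducible B.isClosed
    have hbB : b ∈ (B : Set Z) := hb.mem
    have him : φ '' (A : Set Z) = φ '' B := by
      have := congrArg (fun C : IrreducibleCloseds X => (C : Set X)) h
      simpa [IrreducibleCloseds.coe_map, (hc _ A.isClosed).closure_eq,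
        (hc _ B.isClosed).closure_eq] using this
    obtain ⟨a, ha, hab⟩ : φ b ∈ φ '' (A : Set Z) := him ▸ ⟨b, hbB, rfl⟩
    have : b = a := hs b a (hb.specializes (hle ha)) hab.symm
    subst this
    change (B : Set Z) ⊆ A
    rw [← hb.def]
    exact closure_minimal (by simpa using ha) A.isClosed

/-- Lifts chains downwards: the member just below the top of a chain has its generic point in
`closure {φ z} = φ '' closure {z}`, so that point is `φ w` for a specialization `w` of `z`, and the
induction continues from `w`. -/
theorem height_closure_singleton_image_le {φ : Z → X} [QuasiSober X] (hφ : Continuous φ)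
    (hc : IsClosedMap φ) (n : ℕ) (z : Z) (hn : n ≤ height
      (⟨closure {φ z}, isIrreducible_singleton.closure, isClosed_closure⟩ : IrreducibleCloseds X)) :
    n ≤ height
      (⟨closure {z}, isIrreducible_singleton.closure, isClosed_closure⟩ : IrreducibleCloseds Z) := by
  induction n generalizing z with
  | zero => simp
  | succ n ih =>
    obtain ⟨p, hp, hlen⟩ := exists_series_of_le_height _ hn
    have hlt : p ⟨n, by omega⟩ < p.last := by
      apply p.strictMono
      simp [Fin.lt_def, hlen]
    set C := p ⟨n, by omega⟩
    have hC : n ≤ height C := by simpa using index_le_height p ⟨n, by omega⟩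
    rw [hp] at hlt
    obtain ⟨x, hx⟩ := QuasiSober.sober C.isIrreducible C.isClosed
    have hxC : x ∈ (C : Set X) := hx.mem
    have hcl : φ '' closure {z} = closure {φ z} := by
      rw [← hc.closure_image_eq_of_continuous hφ, Set.image_singleton]
    obtain ⟨w, hw, rfl⟩ : x ∈ φ '' closure {z} := hcl ▸ hlt.le hxC
    have hC' : C = ⟨closure {φ w}, isIrreducible_singleton.closure, isClosed_closure⟩ :=
      IrreducibleCloseds.ext hx.def.symm
    have := ih w (hC' ▸ hC)
    push_cast
    refine le_trans (add_le_add_left this 1) (height_add_one_le (lt_of_le_of_ne ?_ fun h => ?_))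
    · exact closure_minimal (by simpa using hw) isClosed_closure
    · apply hlt.not_ge
      have hz : z ∈ closure {w} := by
        have := congrArg (fun C : IrreducibleCloseds Z => (C : Set Z)) h
        simp only [IrreducibleCloseds.coe_mk] at this
        rw [this]
        exact subset_closure rfl
      rw [hC']
      refine closure_minimal ?_ isClosed_closure
      rw [Set.singleton_subset_iff]
      have h1 : w ⤳ z := specializes_iff_mem_closure.2 hz
      exact specializes_iff_mem_closure.1 (h1.map hφ)

theorem topologicalKrullDim_le_of_surjective {φ : Z → X} [QuasiSober X] (hφ : Continuous φ)
    (hc : IsClosedMap φ) (hs : Function.Surjective φ) :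
    topologicalKrullDim X ≤ topologicalKrullDim Z := by
  rw [topologicalKrullDim, krullDim_eq_iSup_height]
  refine iSup_le fun C => ?_
  obtain ⟨x, hx⟩ := QuasiSober.sober C.isIrreducible C.isClosed
  obtain ⟨z, rfl⟩ := hs x
  have hC' : C = ⟨closure {φ z}, isIrreducible_singleton.closure, isClosed_closure⟩ :=
    IrreducibleCloseds.ext hx.def.symm
  rw [hC']
  refine le_trans (WithBot.coe_le_coe.2 ?_) (height_le_krullDim
    (⟨closure {z}, isIrreducible_singleton.closure, isClosed_closure⟩ : IrreducibleCloseds Z))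
  exact ENat.forall_natCast_le_iff_le.1 fun n hn =>
    height_closure_singleton_image_le hφ hc n z hn

theorem topologicalKrullDim_mono {A B : Set X} (h : A ⊆ B) :
    topologicalKrullDim A ≤ topologicalKrullDim B :=
  (Topology.IsEmbedding.inclusion h).isInducing.topologicalKrullDim_le

theorem topologicalKrullDim_range {f : Z → X} (hf : Topology.IsEmbedding f) :
    topologicalKrullDim (Set.range f) = topologicalKrullDim Z :=
  (IsHomeomorph.topologicalKrullDim_eq _ hf.toHomeomorph.isHomeomorph).symm

/-- If `A ≠ B`, a longest chain in `A` can be extended by `B` itself. The dimension must be finite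
for this to be a contradiction. -/
theorem eq_of_subset_of_topologicalKrullDim_le {A B : Set X} (hA : IsClosed A)
    (hB : IsIrreducible B) (h : A ⊆ B) {d : ℕ}
    (hd : topologicalKrullDim A = d) (hle : topologicalKrullDim B ≤ topologicalKrullDim A) :
    A = B := by
  by_contra hne
  obtain ⟨p, hp⟩ := le_krullDim_iff.1 hd.ge
  let j : IrreducibleCloseds A → IrreducibleCloseds B :=
    IrreducibleCloseds.map (Set.inclusion h) (continuous_inclusion h)
  have hj : StrictMono j :=
    IrreducibleCloseds.map_strictMono_of_isInducing (Topology.IsEmbedding.inclusion h).isInducing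
  have hBi : IrreducibleSpace B := Subtype.irreducibleSpace hB
  let t : IrreducibleCloseds B := ⟨Set.univ, IrreducibleSpace.isIrreducible_univ _, isClosed_univ⟩
  have hclosed : IsClosed (Subtype.val ⁻¹' A : Set B) := hA.preimage continuous_subtype_val
  have hlt : (p.map j hj).last < t := by
    refine lt_of_le_of_ne (fun _ _ => Set.mem_univ _) fun heq => hne ?_
    refine h.antisymm fun b hb => ?_
    have hb' : (⟨b, hb⟩ : B) ∈ ((p.map j hj).last : Set B) := by rw [heq]; exact Set.mem_univ _
    have hsub : ((p.map j hj).last : Set B) ⊆ Subtype.val ⁻¹' A := by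
      rw [LTSeries.last_map]
      refine closure_minimal ?_ hclosed
      rintro _ ⟨a, -, rfl⟩
      exact a.2
    exact hsub hb'
  have h1 := LTSeries.length_le_krullDim ((p.map j hj).snoc t hlt)
  have h2 : ((d + 1 : ℕ) : WithBot ℕ∞) ≤ (d : ℕ) := by
    refine le_trans ?_ (hle.trans hd.le)
    simpa [hp, topologicalKrullDim] using h1
  norm_cast at h2
  omega

theorem exists_topologicalKrullDim_eq_of_isOpenCover {I : Type*} [Finite I] [Nonempty X]
    (U : I → Set X) (hU : ∀ i, IsOpen (U i)) (hcov : ⋃ i, U i = Set.univ) :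
    ∃ i, (U i).Nonempty ∧ topologicalKrullDim X = topologicalKrullDim (U i) := by
  have key : topologicalKrullDim X ≤ ⨆ i, topologicalKrullDim (U i) := by
    rw [topologicalKrullDim, krullDim_eq_iSup_coheight]
    refine iSup_le fun C => ?_
    obtain ⟨x, hx⟩ := C.isIrreducible.nonempty
    obtain ⟨i, hi⟩ := Set.mem_iUnion.1 (hcov.ge (Set.mem_univ x))
    refine le_iSup_of_le i ?_
    -- Codimension is local: the irreducible closed sets containing `C` all meet `U i`, and so
    -- correspond to those of `U i` containing the trace of `C`.
    have hoe : Topology.IsOpenEmbedding (Subtype.val : U i → X) := (hU i).isOpenEmbedding_subtypeVal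
    let e := IrreducibleCloseds.orderIsoOfIsOpenEmbedding (Subtype.val : U i → X) hoe
    let C' : {V : IrreducibleCloseds X | ((Subtype.val : U i → X) ⁻¹' V).Nonempty} :=
      ⟨C, ⟨⟨x, hi⟩, hx⟩⟩
    have hC : IrreducibleCloseds.map (Subtype.val : U i → X) hoe.continuous (e.symm C') = C :=
      congrArg Subtype.val (e.apply_symm_apply C')
    rw [← hC, hoe.coheight_map]
    exact coheight_le_krullDim _
  obtain ⟨x⟩ := ‹Nonempty X›
  obtain ⟨i₀, -⟩ := Set.mem_iUnion.1 (hcov.ge (Set.mem_univ x))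
  have : Nonempty I := ⟨i₀⟩
  obtain ⟨i, hi⟩ := exists_eq_ciSup_of_finite (f := fun i => topologicalKrullDim (U i))
  have heq : topologicalKrullDim X = topologicalKrullDim (U i) :=
    le_antisymm (key.trans hi.ge) (topologicalKrullDim_subspace_le X (U i))
  refine ⟨i, ?_, heq⟩
  by_contra hne
  rw [Set.not_nonempty_iff_eq_empty] at hne
  have h1 : topologicalKrullDim (U i) = ⊥ := by
    rw [topologicalKrullDim, krullDim_eq_bot_iff]
    refine ⟨fun C => ?_⟩
    obtain ⟨y, -⟩ := C.isIrreducible.nonempty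
    exact (hne ▸ y.2 : y.1 ∈ (∅ : Set X))
  have h2 : topologicalKrullDim X ≠ ⊥ := by
    rw [topologicalKrullDim, krullDim_ne_bot_iff]
    exact ⟨⟨closure {x}, isIrreducible_singleton.closure, isClosed_closure⟩⟩
  exact h2 (heq.trans h1)

end Topology

/-! ### Dimension of products of schemes of finite type over a field. -/

section Dimension

universe u

theorem eq_of_specializes_of_isFinite {X Y : Scheme.{u}} (f : X ⟶ Y) [IsFinite f] {p q : X}
    (hpq : p ⤳ q) (h : f p = f q) : p = q := by
  have : DiscreteTopology (f ⁻¹' {f q} : Set X) :=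
    (f.isDiscrete_preimage_singleton (f q)).to_subtype
  have hs : (⟨p, h⟩ : (f ⁻¹' {f q} : Set X)) ⤳ ⟨q, rfl⟩ :=
    Topology.IsInducing.subtypeVal.specializes_iff.1 hpq
  exact congrArg Subtype.val hs.eq

theorem topologicalKrullDim_eq_of_isFinite {X Y : Scheme.{u}} (f : X ⟶ Y) [IsFinite f]
    [Surjective f] : topologicalKrullDim X = topologicalKrullDim Y :=
   le_antisymm (topologicalKrullDim_le_of_specializes_eq f.continuous f.isClosedMap
      fun _ _ => eq_of_specializes_of_isFinite f)
    (topologicalKrullDim_le_of_surjective f.continuous f.isClosedMap f.surjective)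

variable {K : Type u} [Field K]

variable (K) in
noncomputable abbrev affineSpaceTo (d : ℕ) :
    Spec (.of (MvPolynomial (Fin d) K)) ⟶ Spec (.of K) :=
  Spec.map (CommRingCat.ofHom (algebraMap K (MvPolynomial (Fin d) K)))

/-- Noether normalization; an injective integral ring map is surjective on spectra. -/
theorem exists_finite_surjective_to_affineSpace {X : Scheme.{u}} [IsAffine X] [Nonempty X]
    (f : X ⟶ Spec (.of K)) [LocallyOfFiniteType f] :
    ∃ (d : ℕ) (p : X ⟶ Spec (.of (MvPolynomial (Fin d) K))),
      IsFinite p ∧ Surjective p ∧ p ≫ affineSpaceTo K d = f := by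
  obtain ⟨φ, hφ⟩ := Spec.map_surjective (X.isoSpec.inv ≫ f)
  have hft : LocallyOfFiniteType (Spec.map φ) := hφ ▸ inferInstance
  rw [HasRingHomProperty.Spec_iff (P := @LocallyOfFiniteType)] at hft
  algebraize [φ.hom]
  have : Nonempty (Spec Γ(X, ⊤)) := ⟨X.isoSpec.hom (Classical.arbitrary X)⟩
  have : Nontrivial Γ(X, ⊤) := (PrimeSpectrum.nonempty_iff_nontrivial).1 this
  obtain ⟨d, g, hg, hg'⟩ := exists_finite_inj_algHom_of_fg K Γ(X, ⊤)
  have hfin : IsFinite (Spec.map (CommRingCat.ofHom g.toRingHom)) :=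
    (IsFinite.SpecMap_iff _).2 hg'
  have hsurj : Surjective (Spec.map (CommRingCat.ofHom g.toRingHom)) :=
    ⟨hg'.to_isIntegral.comap_surjective hg⟩
  refine ⟨d, X.isoSpec.hom ≫ Spec.map (CommRingCat.ofHom g.toRingHom), inferInstance,
    inferInstance, ?_⟩
  rw [Category.assoc, ← Spec.map_comp, ← CommRingCat.ofHom_comp]
  have : CommRingCat.ofHom (g.toRingHom.comp (algebraMap K (MvPolynomial (Fin d) K))) = φ := by
    ext x
    exact g.commutes x
  rw [this, hφ, Iso.hom_inv_id_assoc]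

theorem topologicalKrullDim_affineSpace (d : ℕ) :
    topologicalKrullDim (Spec (.of (MvPolynomial (Fin d) K))) = d := by
  refine (PrimeSpectrum.topologicalKrullDim_eq_ringKrullDim (MvPolynomial (Fin d) K)).trans ?_
  simp [MvPolynomial.ringKrullDim_of_isNoetherianRing]

theorem topologicalKrullDim_pullback_affineSpace (d e : ℕ) :
    topologicalKrullDim ↥(pullback (affineSpaceTo K d) (affineSpaceTo K e)) = (d + e : ℕ) := by
  let i := pullbackSpecIso K (MvPolynomial (Fin d) K) (MvPolynomial (Fin e) K)
  rw [IsHomeomorph.topologicalKrullDim_eq _ i.hom.homeomorph.isHomeomorph]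
  refine (PrimeSpectrum.topologicalKrullDim_eq_ringKrullDim _).trans ?_
  rw [ringKrullDim_eq_of_ringEquiv (MvPolynomial.algebraTensorAlgEquiv K
    (MvPolynomial (Fin d) K) (σ := Fin e)).toRingEquiv]
  simp [MvPolynomial.ringKrullDim_of_isNoetherianRing]

/-- The product of two Noether normalizations is finite and surjective onto affine space of
dimension `d + e`. -/
theorem topologicalKrullDim_pullback_of_isAffine {X Y : Scheme.{u}} [IsAffine X] [IsAffine Y]
    [Nonempty X] [Nonempty Y] (f : X ⟶ Spec (.of K)) (g : Y ⟶ Spec (.of K))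
    [LocallyOfFiniteType f] [LocallyOfFiniteType g] :
    ∃ d e : ℕ, topologicalKrullDim X = d ∧ topologicalKrullDim Y = e ∧
      topologicalKrullDim ↥(pullback f g) = (d + e : ℕ) := by
  obtain ⟨d, p, _, _, rfl⟩ := exists_finite_surjective_to_affineSpace f
  obtain ⟨e, q, _, _, rfl⟩ := exists_finite_surjective_to_affineSpace g
  refine ⟨d, e, ?_, ?_, ?_⟩
  · rw [topologicalKrullDim_eq_of_isFinite p, topologicalKrullDim_affineSpace]
  · rw [topologicalKrullDim_eq_of_isFinite q, topologicalKrullDim_affineSpace]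
  · let m := pullback.map (p ≫ affineSpaceTo K d) (q ≫ affineSpaceTo K e) (affineSpaceTo K d)
      (affineSpaceTo K e) p q (𝟙 _) (by simp) (by simp)
    have : IsFinite m := MorphismProperty.pullbackMap (P := @IsFinite)
      (i₁ := p) (i₂ := q) ‹_› ‹_› rfl rfl
    have : Surjective m := by
      rw [surjective_iff, ← Set.range_eq_univ, Scheme.Pullback.range_map,
        p.surjective.range_eq, q.surjective.range_eq]
      simp
    rw [topologicalKrullDim_eq_of_isFinite m, topologicalKrullDim_pullback_affineSpace]

theorem exists_openCover_topologicalKrullDim_eq {X : Scheme.{u}} [Nonempty X] (𝒰 : X.OpenCover)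
    [Finite 𝒰.I₀] : ∃ i, Nonempty (𝒰.X i) ∧ topologicalKrullDim X = topologicalKrullDim (𝒰.X i) := by
  obtain ⟨i, ⟨x, y, -⟩, h⟩ := exists_topologicalKrullDim_eq_of_isOpenCover
    (fun i : 𝒰.I₀ => Set.range (𝒰.f i)) (fun i => (𝒰.f i).isOpenEmbedding.isOpen_range)
    𝒰.iUnion_range
  exact ⟨i, ⟨y⟩, h.trans (topologicalKrullDim_range (𝒰.f i).isOpenEmbedding.isEmbedding)⟩

/-- The dimension of a product of schemes of finite type over a field is the sum of
the dimensions. -/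
theorem topologicalKrullDim_pullback {X Y : Scheme.{u}} [Nonempty X] [Nonempty Y]
    (f : X ⟶ Spec (.of K)) (g : Y ⟶ Spec (.of K)) [LocallyOfFiniteType f] [LocallyOfFiniteType g]
    [QuasiCompact f] [QuasiCompact g] :
    ∃ d e : ℕ, topologicalKrullDim X = d ∧ topologicalKrullDim Y = e ∧
      topologicalKrullDim ↥(pullback f g) = (d + e : ℕ) := by
  have := QuasiCompact.compactSpace_of_compactSpace f
  have := QuasiCompact.compactSpace_of_compactSpace g
  let 𝒰 := X.affineCover.finiteSubcover
  let 𝒱 := Y.affineCover.finiteSubcover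
  let 𝒲 := Scheme.Pullback.openCoverOfLeftRight 𝒰 𝒱 f g
  have : Finite 𝒲.I₀ := inferInstanceAs (Finite (𝒰.I₀ × 𝒱.I₀))
  have (i : 𝒰.I₀) : IsAffine (𝒰.X i) := inferInstanceAs (IsAffine (X.affineCover.X _))
  have (i : 𝒱.I₀) : IsAffine (𝒱.X i) := inferInstanceAs (IsAffine (Y.affineCover.X _))
  obtain ⟨z, -, -⟩ := Scheme.Pullback.exists_preimage_pullback (f := f) (g := g)
    (Classical.arbitrary X) (Classical.arbitrary Y) (Subsingleton.elim _ _)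
  have : Nonempty ↥(pullback f g) := ⟨z⟩
  obtain ⟨i, _, hi⟩ := exists_openCover_topologicalKrullDim_eq 𝒰
  obtain ⟨j, _, hj⟩ := exists_openCover_topologicalKrullDim_eq 𝒱
  -- The chart `(i', j')` computing the dimension of the product need not be the pair `(i, j)`
  -- computing those of the factors. Comparing both ways, `d + e ≤ d' + e'`, `d' ≤ d` and `e' ≤ e`,
  -- gives equality.
  obtain ⟨⟨i', j'⟩, hw, hij⟩ := exists_openCover_topologicalKrullDim_eq 𝒲
  obtain ⟨d, e, hd, he, hde⟩ :=
    topologicalKrullDim_pullback_of_isAffine (𝒰.f i ≫ f) (𝒱.f j ≫ g)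
  let k : 𝒲.I₀ := (i, j)
  have hle : topologicalKrullDim ↥(pullback (𝒰.f i ≫ f) (𝒱.f j ≫ g)) ≤
      topologicalKrullDim ↥(pullback f g) :=
    (𝒲.f k).isOpenEmbedding.isInducing.topologicalKrullDim_le
  obtain ⟨w⟩ := hw
  have : Nonempty (𝒰.X i') := ⟨pullback.fst (𝒰.f i' ≫ f) (𝒱.f j' ≫ g) w⟩
  have : Nonempty (𝒱.X j') := ⟨pullback.snd (𝒰.f i' ≫ f) (𝒱.f j' ≫ g) w⟩
  obtain ⟨d', e', hd', he', hde'⟩ :=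
    topologicalKrullDim_pullback_of_isAffine (𝒰.f i' ≫ f) (𝒱.f j' ≫ g)
  have hij' : topologicalKrullDim ↥(pullback f g) = (d' + e' : ℕ) := hij.trans hde'
  have h1 := (𝒰.f i').isOpenEmbedding.isInducing.topologicalKrullDim_le
  have h2 := (𝒱.f j').isOpenEmbedding.isInducing.topologicalKrullDim_le
  rw [hi, hd, hd'] at h1
  rw [hj, he, he'] at h2
  rw [hij', hde] at hle
  refine ⟨d, e, hi.trans hd, hj.trans he, hij'.trans ?_⟩
  norm_cast at h1 h2 hle ⊢
  omega

end Dimension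

/-! ### Powers of varieties over `ℂ`: irreducibility and finite maps. -/

noncomputable section
namespace SpecialGraphs

/-- `X ^ (n + 1)` is `X × X ^ n`. -/
def powerSucc (X : SchC) (n : ℕ) : power X (n + 1) ≅ X ⊗ power X n where
  hom := CartesianMonoidalCategory.lift (Pi.π _ 0) (Pi.lift fun i => Pi.π _ i.succ)
  inv := Pi.lift (Fin.cons (CartesianMonoidalCategory.fst _ _)
    fun i => CartesianMonoidalCategory.snd _ _ ≫ Pi.π _ i)
  hom_inv_id := by
    refine Pi.hom_ext _ _ fun i => ?_
    cases i using Fin.cases <;> simp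
  inv_hom_id := by
    ext1
    · simp
    · refine Eq.trans ?_ (Category.id_comp _).symm
      refine Pi.hom_ext _ _ fun i => ?_
      simp

theorem isIso_left {X Y : SchC} (f : X ⟶ Y) [IsIso f] : IsIso f.left :=
  inferInstanceAs (IsIso ((Over.forget _).map f))

def powerZero (X : SchC) : power X 0 ≅ 𝟙_ SchC where
  hom := CartesianMonoidalCategory.toUnit _
  inv := Pi.lift fun i => i.elim0
  hom_inv_id := Pi.hom_ext _ _ fun i => i.elim0
  inv_hom_id := CartesianMonoidalCategory.toUnit_unique _ _

/-- The second projection is open, so the images of two nonempty open sets meet, and they share a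
closed point `c` because `Y` is Jacobson. As `ℂ` is algebraically closed, `c` is rational and its
fibre is a copy of `X`. Both open sets meet this irreducible fibre, hence each other. -/
theorem irreducibleSpace_tensor (X Y : SchC) [IrreducibleSpace X.left] [IrreducibleSpace Y.left]
    [LocallyOfFiniteType X.hom] [LocallyOfFiniteType Y.hom] :
    IrreducibleSpace (X ⊗ Y).left := by
  change IrreducibleSpace ↥(pullback X.hom Y.hom)
  have hopen : IsOpenMap (pullback.snd X.hom Y.hom) := (pullback.snd X.hom Y.hom).isOpenMap
  have hjac : JacobsonSpace Y.left := LocallyOfFiniteType.jacobsonSpace Y.hom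
  obtain ⟨z, -, -⟩ := Scheme.Pullback.exists_preimage_pullback (f := X.hom) (g := Y.hom)
    (Classical.arbitrary _) (Classical.arbitrary _) (Subsingleton.elim _ _)
  have : Nonempty ↥(pullback X.hom Y.hom) := ⟨z⟩
  refine @IrreducibleSpace.mk _ _ ⟨?_⟩ this
  intro U U' hU hU' ⟨u, _, hu⟩ ⟨u', _, hu'⟩
  obtain ⟨y, -, hy, hy'⟩ := (IrreducibleSpace.isIrreducible_univ Y.left).isPreirreducible _ _
    (hopen _ hU) (hopen _ hU') ⟨_, trivial, u, hu, rfl⟩ ⟨_, trivial, u', hu', rfl⟩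
  obtain ⟨c, ⟨⟨v, hv, hvc⟩, ⟨v', hv', hvc'⟩⟩, hc⟩ := nonempty_inter_closedPoints
    (Z := pullback.snd X.hom Y.hom '' U ∩ pullback.snd X.hom Y.hom '' U')
    ⟨y, hy, hy'⟩ ((hopen _ hU).inter (hopen _ hU')).isLocallyClosed
  let t : Spec (.of ℂ) ⟶ Y.left := pointOfClosedPoint Y.hom c hc
  have ht : t ≫ Y.hom = 𝟙 _ := pointOfClosedPoint_comp Y.hom c hc
  have htr : Set.range t = {c} := by
    ext a
    simp only [t, Set.mem_range, Set.mem_singleton_iff]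
    constructor
    · rintro ⟨b, rfl⟩
      exact pointOfClosedPoint_apply Y.hom c hc b
    · rintro rfl
      exact ⟨IsLocalRing.closedPoint ℂ, pointOfClosedPoint_apply Y.hom a hc _⟩
  -- The inclusion of the fibre over `c`; its source is isomorphic to `X`.
  let s : pullback X.hom (𝟙 (Spec (.of ℂ))) ⟶ pullback X.hom Y.hom :=
    pullback.map _ _ _ _ (𝟙 _) t (𝟙 _) (by simp) (by simp [ht])
  have : IrreducibleSpace ↥(pullback X.hom (𝟙 (Spec (.of ℂ)))) :=
    (pullback.fst X.hom (𝟙 (Spec (.of ℂ)))).homeomorph.irreducibleSpace_iff.2 inferInstance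
  have hrange : Set.range s = pullback.snd X.hom Y.hom ⁻¹' {c} := by
    rw [Scheme.Pullback.range_map, htr]
    simp
  obtain ⟨a, rfl⟩ : v ∈ Set.range s := hrange ▸ hvc
  obtain ⟨a', rfl⟩ : v' ∈ Set.range s := hrange ▸ hvc'
  obtain ⟨b, -, hb, hb'⟩ := (IrreducibleSpace.isIrreducible_univ _).isPreirreducible _ _
    (hU.preimage s.continuous) (hU'.preimage s.continuous) ⟨a, trivial, hv⟩ ⟨a', trivial, hv'⟩
  exact ⟨s b, trivial, hb, hb'⟩

theorem isFinite_power_map {X Y : SchC} (f : X ⟶ Y) [IsFinite f.left] (n : ℕ) :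
    IsFinite (Limits.Pi.map (fun _ : Fin n => f)).left := by
  induction n with
  | zero =>
    have : IsIso (Limits.Pi.map (fun _ : Fin 0 => f)) := by
      refine ⟨Pi.lift fun i => i.elim0, Pi.hom_ext _ _ fun i => i.elim0,
        Pi.hom_ext _ _ fun i => i.elim0⟩
    have := isIso_left (Limits.Pi.map (fun _ : Fin 0 => f))
    infer_instance
  | succ n ih =>
    have : Limits.Pi.map (fun _ : Fin (n + 1) => f) = (powerSucc X n).hom ≫
        (f ⊗ₘ Limits.Pi.map (fun _ : Fin n => f)) ≫ (powerSucc Y n).inv := by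
      refine Pi.hom_ext _ _ fun i => ?_
      cases i using Fin.cases <;> simp [powerSucc]
    rw [this, Over.comp_left, Over.comp_left]
    have : IsFinite (f ⊗ₘ Limits.Pi.map (fun _ : Fin n => f)).left :=
      MorphismProperty.pullbackMap (P := @IsFinite) (i₁ := f.left)
        (i₂ := (Limits.Pi.map (fun _ : Fin n => f)).left) ‹_› ‹_› (by simp) (by simp)
    have := isIso_left (powerSucc X n).hom
    have := isIso_left (powerSucc Y n).inv
    infer_instance

/-- `X` is irreducible, separated and of finite type over `ℂ`. -/
structure IsIrreducibleVariety (X : SchC) : Prop where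
  irreducibleSpace : IrreducibleSpace X.left
  locallyOfFiniteType : LocallyOfFiniteType X.hom
  quasiCompact : QuasiCompact X.hom
  isSeparated : IsSeparated X.hom

theorem isIrreducibleVariety_power {X : SchC} (hX : IsIrreducibleVariety X) (n : ℕ) :
    IsIrreducibleVariety (power X n) := by
  induction n with
  | zero =>
    have hiso : IsIso (power X 0).hom := by
      have : (power X 0).hom = (powerZero X).hom.left := by
        simpa using (Over.w (powerZero X).hom).symm
      rw [this]
      exact isIso_left _
    exact ⟨(power X 0).hom.homeomorph.irreducibleSpace_iff.2 inferInstance, inferInstance,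
      inferInstance, inferInstance⟩
  | succ n ih =>
    have := isIso_left (powerSucc X n).hom
    have := hX.1; have := hX.2; have := hX.3; have := hX.4
    have := ih.1; have := ih.2; have := ih.3; have := ih.4
    have h1 : LocallyOfFiniteType (X ⊗ power X n).hom :=
      inferInstanceAs (LocallyOfFiniteType (pullback.fst _ _ ≫ X.hom))
    have h2 : QuasiCompact (X ⊗ power X n).hom :=
      inferInstanceAs (QuasiCompact (pullback.fst _ _ ≫ X.hom))
    have h4 : IsSeparated (X ⊗ power X n).hom :=
      inferInstanceAs (IsSeparated (pullback.fst _ _ ≫ X.hom))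
    have h3 := irreducibleSpace_tensor X (power X n)
    refine ⟨(powerSucc X n).hom.left.homeomorph.irreducibleSpace_iff.2 h3, ?_, ?_, ?_⟩ <;>
    · rw [← Over.w (powerSucc X n).hom]
      infer_instance

end SpecialGraphs
end

/-! ### Finite fibres of dominant closed maps between curves. -/

noncomputable section

section Curves

open TopologicalSpace Order

variable {X Z : Type*} [TopologicalSpace X] [TopologicalSpace Z]

/-- In dimension at most one, an irreducible closed set is minimal or maximal. A proper one is
minimal, so each of its points is generic in it, and generic points are unique. -/
theorem subsingleton_of_topologicalKrullDim_le_one [QuasiSober X] [T0Space X] [IrreducibleSpace X]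
    (hX : topologicalKrullDim X ≤ 1) {A : Set X} (hA : IsClosed A) (hA' : IsIrreducible A)
    (hne : A ≠ Set.univ) : A.Subsingleton := by
  let A' : IrreducibleCloseds X := ⟨A, hA', hA⟩
  rcases krullDim_le_one_iff.1 hX A' with h | h
  · have key : ∀ b ∈ A, closure {b} = A := fun b hb =>
      (closure_minimal (Set.singleton_subset_iff.2 hb) hA).antisymm
        (@h ⟨closure {b}, isIrreducible_singleton.closure, isClosed_closure⟩
          (closure_minimal (Set.singleton_subset_iff.2 hb) hA))
    intro a ha b hb
    exact (show IsGenericPoint a A from key a ha).eq (key b hb)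
  · exact absurd (Set.univ_subset_iff.1 (@h ⟨Set.univ, IrreducibleSpace.isIrreducible_univ X,
      isClosed_univ⟩ (Set.subset_univ _))) hne

theorem finite_preimage_singleton_of_dominant [QuasiSober X] [T0Space X] [IrreducibleSpace X]
    [NoetherianSpace X] [T0Space Z]
    (hX : topologicalKrullDim X ≤ 1) (hZ : topologicalKrullDim Z = 1) {f : X → Z}
    (hf : Continuous f) (hc : IsClosedMap f) (hd : DenseRange f) (z : Z) : (f ⁻¹' {z}).Finite := by
  have hη : closure {f (genericPoint X)} = Set.univ := by
    rw [← Set.image_singleton, hc.closure_image_eq_of_continuous hf, genericPoint_closure,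
      Set.image_univ, ← hd.closure_range, (hc.isClosed_range).closure_eq]
  -- This case says that `z` is the generic point of `Z`. Any other point of its fibre would be
  -- closed with closed image, so `Z` would be a single point, of dimension zero. In the remaining
  -- case, the preimage of `closure {z}` is closed and misses the generic point of `X`, so its
  -- finitely many irreducible pieces are points.
  by_cases hz : f (genericPoint X) ∈ closure {z}
  · have hzη : z = f (genericPoint X) := by
      have h1 : z ⤳ f (genericPoint X) := specializes_iff_mem_closure.2 hz
      have h2 : f (genericPoint X) ⤳ z := specializes_iff_mem_closure.2 (hη ▸ Set.mem_univ z)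
      exact (h1.antisymm h2).eq
    refine (Set.finite_singleton (genericPoint X)).subset fun x hx => ?_
    by_contra hne
    have hcl : IsClosed ({x} : Set X) := by
      have hs := subsingleton_of_topologicalKrullDim_le_one hX (isClosed_closure (s := {x}))
        isIrreducible_singleton.closure fun h => hne ((show IsGenericPoint x Set.univ from h).eq
          (genericPoint_spec X))
      have : closure {x} = {x} := hs.eq_singleton_of_mem (subset_closure rfl)
      exact this ▸ isClosed_closure
    have h1 : IsClosed ({z} : Set Z) := by
      have := hc _ hcl
      rwa [Set.image_singleton, show f x = z from hx] at this
    have h2 : ({z} : Set Z) = Set.univ := by rw [← h1.closure_eq, hzη, hη]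
    have : Subsingleton Z := Set.subsingleton_univ_iff.1 (h2 ▸ Set.subsingleton_singleton)
    have h3 := topologicalKrullDim_zero_of_discreteTopology Z
    rw [hZ] at h3
    exact absurd h3 (by decide)
  · have hcl : IsClosed (f ⁻¹' closure {z}) := isClosed_closure.preimage hf
    obtain ⟨S, hS, hSc, hSi, hSU⟩ := NoetherianSpace.exists_finite_set_isClosed_irreducible hcl
    refine Set.Finite.subset (s := f ⁻¹' closure {z}) ?_ (Set.preimage_mono subset_closure)
    rw [hSU]
    refine hS.sUnion fun t ht => Set.Subsingleton.finite ?_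
    refine subsingleton_of_topologicalKrullDim_le_one hX (hSc t ht) (hSi t ht) fun htu => hz ?_
    have : genericPoint X ∈ ⋃₀ S := ⟨t, ht, htu ▸ Set.mem_univ _⟩
    rwa [← hSU] at this

end Curves

/-! ### Reduced closed subschemes. -/

namespace SpecialGraphs

variable {X : SchC} {A : Set X.left} (hA : IsClosed A)

/-- The closed subscheme, with its reduced structure, on a closed subset. -/
def closedSubscheme : SchC :=
  Over.mk ((Scheme.IdealSheafData.vanishingIdeal ⟨A, hA⟩).subschemeι ≫ X.hom)

def closedSubschemeι : closedSubscheme hA ⟶ X :=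
  Over.homMk (Scheme.IdealSheafData.vanishingIdeal ⟨A, hA⟩).subschemeι rfl

instance : IsClosedImmersion (closedSubschemeι hA).left :=
  inferInstanceAs (IsClosedImmersion (Scheme.IdealSheafData.vanishingIdeal ⟨A, hA⟩).subschemeι)

theorem range_closedSubschemeι : Set.range (closedSubschemeι hA).left = A := by
  refine (Scheme.IdealSheafData.range_subschemeι _).trans ?_
  simp

theorem closedSubscheme_hom : (closedSubscheme hA).hom = (closedSubschemeι hA).left ≫ X.hom := rfl

instance [LocallyOfFiniteType X.hom] : LocallyOfFiniteType (closedSubscheme hA).hom := by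
  rw [closedSubscheme_hom]; infer_instance

instance [QuasiCompact X.hom] : QuasiCompact (closedSubscheme hA).hom := by
  rw [closedSubscheme_hom]; infer_instance

instance [IsSeparated X.hom] : IsSeparated (closedSubscheme hA).hom := by
  rw [closedSubscheme_hom]; infer_instance

theorem topologicalKrullDim_closedSubscheme :
    topologicalKrullDim (closedSubscheme hA).left = topologicalKrullDim A := by
  rw [← topologicalKrullDim_range (closedSubschemeι hA).left.isEmbedding, range_closedSubschemeι]

theorem nonempty_closedSubscheme (h : A.Nonempty) : Nonempty (closedSubscheme hA).left := by
  obtain ⟨a, ha⟩ := h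
  rw [← range_closedSubschemeι hA] at ha
  exact ⟨ha.choose⟩

theorem irreducibleSpace_closedSubscheme (h : IsIrreducible A) :
    IrreducibleSpace (closedSubscheme hA).left := by
  have h1 : IrreducibleSpace (Set.range (closedSubschemeι hA).left) := by
    rw [range_closedSubschemeι]; exact Subtype.irreducibleSpace h
  exact (closedSubschemeι hA).left.isEmbedding.toHomeomorph.irreducibleSpace_iff.2 h1

/-- A morphism from the spectrum of a field into a closed subset lifts to the closed subscheme. -/
theorem exists_lift_closedSubscheme {P : SchC} [IsReduced P.left] (f : P ⟶ X)
    (h : ∀ p, f.left p ∈ A) : ∃ l : P ⟶ closedSubscheme hA, l ≫ closedSubschemeι hA = f := by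
  let q := pullback.fst f.left (closedSubschemeι hA).left
  have : Surjective q := by
    rw [surjective_iff, ← Set.range_eq_univ, Scheme.Pullback.range_fst, range_closedSubschemeι]
    exact Set.eq_univ_of_forall h
  -- A surjective closed immersion into a reduced scheme is an isomorphism.
  have : IsIso q := isIso_of_isClosedImmersion_of_surjective q
  have key : (inv q ≫ pullback.snd f.left (closedSubschemeι hA).left) ≫
      (closedSubschemeι hA).left = f.left := by
    rw [Category.assoc, ← pullback.condition, IsIso.inv_hom_id_assoc]
  refine ⟨Over.homMk (inv q ≫ pullback.snd _ _) ?_, ?_⟩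
  · rw [closedSubscheme_hom, ← Category.assoc, key, Over.w]
  · ext1
    exact key

/-- With reduced structures on `A` and `B`, the set in question is the range of a closed immersion
of their product, so the scheme-theoretic formula applies. -/
theorem topologicalKrullDim_prod {X Z : SchC} [LocallyOfFiniteType X.hom] [QuasiCompact X.hom]
    [LocallyOfFiniteType Z.hom] [QuasiCompact Z.hom] {A : Set X.left} {B : Set Z.left}
    (hA : IsClosed A) (hB : IsClosed B) (hA' : A.Nonempty) (hB' : B.Nonempty) :
    ∃ d e : ℕ, topologicalKrullDim A = d ∧ topologicalKrullDim B = e ∧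
      topologicalKrullDim ↥((CartesianMonoidalCategory.fst X Z).left ⁻¹' A ∩
        (CartesianMonoidalCategory.snd X Z).left ⁻¹' B) = (d + e : ℕ) := by
  have := nonempty_closedSubscheme hA hA'
  have := nonempty_closedSubscheme hB hB'
  obtain ⟨d, e, hd, he, hde⟩ :=
    topologicalKrullDim_pullback (closedSubscheme hA).hom (closedSubscheme hB).hom
  refine ⟨d, e, (topologicalKrullDim_closedSubscheme hA).symm.trans hd,
    (topologicalKrullDim_closedSubscheme hB).symm.trans he, hde ▸ ?_⟩
  let m := pullback.map (closedSubscheme hA).hom (closedSubscheme hB).hom X.hom Z.hom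
    (closedSubschemeι hA).left (closedSubschemeι hB).left (𝟙 _) (by simp) (by simp)
  have hfin : IsFinite m := MorphismProperty.pullbackMap (P := @IsFinite)
    (i₁ := (closedSubschemeι hA).left) (i₂ := (closedSubschemeι hB).left) inferInstance
    inferInstance (by simp) (by simp)
  have hmono : Mono m := MorphismProperty.pullbackMap (P := MorphismProperty.monomorphisms _)
    (i₁ := (closedSubschemeι hA).left) (i₂ := (closedSubschemeι hB).left) (.infer_property _)
    (.infer_property _) (by simp) (by simp)
  have : IsClosedImmersion m := IsClosedImmersion.iff_isFinite_and_mono m |>.2 ⟨hfin, hmono⟩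
  have hr : Set.range m = (CartesianMonoidalCategory.fst X Z).left ⁻¹' A ∩
        (CartesianMonoidalCategory.snd X Z).left ⁻¹' B := by
    refine (Scheme.Pullback.range_map ..).trans ?_
    rw [range_closedSubschemeι, range_closedSubschemeι]
    rfl
  rw [← hr]
  exact topologicalKrullDim_range m.isEmbedding

end SpecialGraphs
end

/-! ### Finiteness of `Vⁿ` over `Yⁿ` and its consequences. -/

noncomputable section
namespace SpecialGraphs

variable {Y : ShimuraCurve} {E : SchC} {V : Set (Y.curve ⊗ E).left}

theorem ShimuraCurve.isIrreducibleVariety (Y : ShimuraCurve) : IsIrreducibleVariety Y.curve := by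
  have := Y.isIntegral
  exact ⟨inferInstance, Y.locallyOfFiniteType, Y.quasiCompact, Y.isSeparated⟩

theorem IsEllipticCurve.isIrreducibleVariety [GrpObj E] (hE : IsEllipticCurve E) :
    IsIrreducibleVariety E := by
  have := hE.isIntegral
  have := hE.isProper
  exact ⟨inferInstance, inferInstance, inferInstance, inferInstance⟩

/-- A proper quasi-finite morphism is finite; properness comes from `E`, quasi-finiteness from
dominance between curves. -/
theorem isFinite_closedSubscheme_fst [GrpObj E] (hE : IsEllipticCurve E)
    (hV : IsCorrespondence Y E V) :
    IsFinite (closedSubschemeι hV.isSubvariety.1 ≫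
      CartesianMonoidalCategory.fst Y.curve E).left := by
  set j := closedSubschemeι hV.isSubvariety.1
  have := hE.isProper
  have := Y.isIntegral
  have := Y.isIrreducibleVariety.2
  have := Y.isIrreducibleVariety.3
  have := irreducibleSpace_closedSubscheme hV.isSubvariety.1 hV.isSubvariety.2
  have hlft : LocallyOfFiniteType (closedSubscheme hV.isSubvariety.1).hom := by
    rw [closedSubscheme_hom]
    exact inferInstanceAs (LocallyOfFiniteType (j.left ≫ pullback.fst _ _ ≫ Y.curve.hom))
  have hqc : QuasiCompact (closedSubscheme hV.isSubvariety.1).hom := by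
    rw [closedSubscheme_hom]
    exact inferInstanceAs (QuasiCompact (j.left ≫ pullback.fst _ _ ≫ Y.curve.hom))
  have h1 : IsProper (j ≫ CartesianMonoidalCategory.fst Y.curve E).left :=
    inferInstanceAs (IsProper (j.left ≫ pullback.fst _ _))
  have h2 : LocallyQuasiFinite (j ≫ CartesianMonoidalCategory.fst Y.curve E).left := by
    have := LocallyOfFiniteType.isLocallyNoetherian (closedSubscheme hV.isSubvariety.1).hom
    have := QuasiCompact.compactSpace_of_compactSpace (closedSubscheme hV.isSubvariety.1).hom
    have : IsNoetherian (closedSubscheme hV.isSubvariety.1).left := {}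
    refine .of_finite_preimage_singleton _ fun y => ?_
    refine finite_preimage_singleton_of_dominant ?_ Y.dim_eq_one
      (Scheme.Hom.continuous _) (Scheme.Hom.isClosedMap _) ?_ y
    · rw [topologicalKrullDim_closedSubscheme, hV.dim_eq_one]
    · have := hV.dominant
      rw [← range_closedSubschemeι hV.isSubvariety.1, ← Set.range_comp] at this
      exact this
  exact .of_isProper_of_locallyQuasiFinite _

/-- The projection `(Y × E)ⁿ ⊇ Vⁿ → Yⁿ`. -/
def correspondencePowerToY (hV : IsClosed V) (n : ℕ) :
    power (closedSubscheme hV) n ⟶ power Y.curve n :=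
  Limits.Pi.map fun _ => closedSubschemeι hV ≫ CartesianMonoidalCategory.fst Y.curve E

def correspondencePowerToAmbient (hV : IsClosed V) (n : ℕ) :
    power (closedSubscheme hV) n ⟶ ambient Y E n :=
  CartesianMonoidalCategory.lift (correspondencePowerToY hV n)
    (Limits.Pi.map fun _ => closedSubschemeι hV ≫ CartesianMonoidalCategory.snd Y.curve E)

theorem projY_correspondencePowerToAmbient (hV : IsClosed V) (n : ℕ)
    (t : (power (closedSubscheme hV) n).left) :
    projY Y E n ((correspondencePowerToAmbient hV n).left t) =
      (correspondencePowerToY hV n).left t := by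
  rw [projY, ← Scheme.Hom.comp_apply, ← Over.comp_left, correspondencePowerToAmbient,
    CartesianMonoidalCategory.lift_fst]

/-- The projection to the `i`-th copy of `Y × E` as a morphism over `ℂ`. -/
def projPairHom (Y : ShimuraCurve) (E : SchC) (n : ℕ) (i : Fin n) : ambient Y E n ⟶ Y.curve ⊗ E :=
  CartesianMonoidalCategory.lift
    (CartesianMonoidalCategory.fst (power Y.curve n) (power E n) ≫ Pi.π (fun _ => Y.curve) i)
    (CartesianMonoidalCategory.snd (power Y.curve n) (power E n) ≫ Pi.π (fun _ => E) i)

/-- Identifies the set `powerSet V n` with the image of an honest scheme power. A point of a product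
is not a tuple of points, so the converse inclusion lifts the residue field point of `p` coordinate
by coordinate. -/
theorem range_correspondencePowerToAmbient (hV : IsClosed V) (n : ℕ) :
    Set.range (correspondencePowerToAmbient hV n).left = powerSet V n := by
  ext p
  constructor
  · rintro ⟨t, rfl⟩ i
    have h : correspondencePowerToAmbient hV n ≫ projPairHom Y E n i =
        Pi.π _ i ≫ closedSubschemeι hV := by
      ext1 <;> simp [projPairHom, correspondencePowerToAmbient, correspondencePowerToY]
    change (projPairHom Y E n i).left ((correspondencePowerToAmbient hV n).left t) ∈ V
    rw [← Scheme.Hom.comp_apply, ← Over.comp_left, h, Over.comp_left, Scheme.Hom.comp_apply]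
    exact (range_closedSubschemeι hV).subset ⟨_, rfl⟩
  · intro hp
    let P : SchC := Over.mk ((ambient Y E n).left.fromSpecResidueField p ≫ (ambient Y E n).hom)
    let ρ : P ⟶ ambient Y E n := Over.homMk ((ambient Y E n).left.fromSpecResidueField p) rfl
    have hρ : ∀ a, ρ.left a = p := Scheme.fromSpecResidueField_apply p
    have : IsReduced P.left :=
      inferInstanceAs (IsReduced (Spec ((ambient Y E n).left.residueField p)))
    have hl : ∀ i, ∃ l : P ⟶ closedSubscheme hV,
        l ≫ closedSubschemeι hV = ρ ≫ projPairHom Y E n i := fun i =>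
      exists_lift_closedSubscheme hV (ρ ≫ projPairHom Y E n i) fun a => by
        rw [Over.comp_left, Scheme.Hom.comp_apply, hρ]
        exact hp i
    choose l hl using hl
    have key : Pi.lift l ≫ correspondencePowerToAmbient hV n = ρ := by
      ext1
      · refine Pi.hom_ext _ _ fun i => ?_
        have := congrArg (· ≫ CartesianMonoidalCategory.fst _ _) (hl i)
        simpa [projPairHom, correspondencePowerToAmbient, correspondencePowerToY] using this
      · refine Pi.hom_ext _ _ fun i => ?_
        have := congrArg (· ≫ CartesianMonoidalCategory.snd _ _) (hl i)
        simpa [projPairHom, correspondencePowerToAmbient, correspondencePowerToY] using this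
    let a : P.left := IsLocalRing.closedPoint ((ambient Y E n).left.residueField p)
    refine ⟨(Pi.lift l).left a, ?_⟩
    rw [← Scheme.Hom.comp_apply, ← Over.comp_left, key, hρ]

variable [GrpObj E] (hE : IsEllipticCurve E) (hV : IsCorrespondence Y E V) (n : ℕ)
include hE hV

theorem isFinite_correspondencePowerToY :
    IsFinite (correspondencePowerToY hV.isSubvariety.1 n).left :=
  have := isFinite_closedSubscheme_fst hE hV
  isFinite_power_map _ n

/-- Followed by the separated projection to `Yⁿ`, the map becomes finite; universal closedness then
cancels. -/
theorem isClosedMap_correspondencePowerToAmbient :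
    IsClosedMap (correspondencePowerToAmbient hV.isSubvariety.1 n).left := by
  have h1 := isFinite_correspondencePowerToY hE hV n
  have h2 := (isIrreducibleVariety_power hE.isIrreducibleVariety n).isSeparated
  have h3 : IsSeparated (CartesianMonoidalCategory.fst (power Y.curve n) (power E n)).left :=
    inferInstanceAs (IsSeparated (pullback.fst _ _))
  have h4 : (correspondencePowerToAmbient hV.isSubvariety.1 n).left ≫
      (CartesianMonoidalCategory.fst (power Y.curve n) (power E n)).left =
      (correspondencePowerToY hV.isSubvariety.1 n).left := by
    rw [← Over.comp_left, correspondencePowerToAmbient, CartesianMonoidalCategory.lift_fst]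
  have : UniversallyClosed ((correspondencePowerToAmbient hV.isSubvariety.1 n).left ≫
      (CartesianMonoidalCategory.fst (power Y.curve n) (power E n)).left) := by
    rw [h4]; infer_instance
  have := UniversallyClosed.of_comp_of_isSeparated
    (correspondencePowerToAmbient hV.isSubvariety.1 n).left
    (CartesianMonoidalCategory.fst (power Y.curve n) (power E n)).left
  exact Scheme.Hom.isClosedMap _

theorem isSubvariety_powerSet : IsSubvariety (powerSet V n) := by
  have hcl := isClosedMap_correspondencePowerToAmbient hE hV n
  have hVs : IsIrreducibleVariety (closedSubscheme hV.isSubvariety.1) := by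
    have := irreducibleSpace_closedSubscheme hV.isSubvariety.1 hV.isSubvariety.2
    have h1 := Y.isIrreducibleVariety
    have h2 := hE.isIrreducibleVariety
    have := h1.2; have := h1.3; have := h1.4; have := h2.2; have := h2.3; have := h2.4
    have : LocallyOfFiniteType (Y.curve ⊗ E).hom :=
      inferInstanceAs (LocallyOfFiniteType (pullback.fst _ _ ≫ Y.curve.hom))
    have : QuasiCompact (Y.curve ⊗ E).hom :=
      inferInstanceAs (QuasiCompact (pullback.fst _ _ ≫ Y.curve.hom))
    have : IsSeparated (Y.curve ⊗ E).hom :=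
      inferInstanceAs (IsSeparated (pullback.fst _ _ ≫ Y.curve.hom))
    exact ⟨inferInstance, inferInstance, inferInstance, inferInstance⟩
  have := (isIrreducibleVariety_power hVs n).irreducibleSpace
  rw [← range_correspondencePowerToAmbient hV.isSubvariety.1]
  refine ⟨hcl.isClosed_range, ?_⟩
  rw [← Set.image_univ]
  exact (IrreducibleSpace.isIrreducible_univ _).image _ (Scheme.Hom.continuous _).continuousOn

theorem isClosed_projY_image {C : Set (ambient Y E n).left} (hC : IsClosed C)
    (hCV : C ⊆ powerSet V n) : IsClosed (projY Y E n '' C) := by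
  have := isFinite_correspondencePowerToY hE hV n
  have h : projY Y E n '' C = (correspondencePowerToY hV.isSubvariety.1 n).left ''
      ((correspondencePowerToAmbient hV.isSubvariety.1 n).left ⁻¹' C) := by
    rw [← range_correspondencePowerToAmbient hV.isSubvariety.1] at hCV
    rw [← Set.image_preimage_eq_of_subset hCV, ← Set.image_comp,
      Set.preimage_image_preimage]
    exact Set.image_congr fun t _ => projY_correspondencePowerToAmbient _ n t
  rw [h]
  exact Scheme.Hom.isClosedMap _ _ (hC.preimage (Scheme.Hom.continuous _))

theorem eq_of_specializes_of_projY_eq {p q : (ambient Y E n).left} (hp : p ∈ powerSet V n)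
    (hpq : p ⤳ q) (h : projY Y E n p = projY Y E n q) : p = q := by
  have := isFinite_correspondencePowerToY hE hV n
  have hcl := isClosedMap_correspondencePowerToAmbient hE hV n
  rw [← range_correspondencePowerToAmbient hV.isSubvariety.1] at hp
  obtain ⟨t, rfl⟩ := hp
  have hq := specializes_iff_mem_closure.1 hpq
  rw [← Set.image_singleton, hcl.closure_image_eq_of_continuous (Scheme.Hom.continuous _)] at hq
  obtain ⟨t', ht', rfl⟩ := hq
  rw [projY_correspondencePowerToAmbient, projY_correspondencePowerToAmbient] at h
  rw [eq_of_specializes_of_isFinite (correspondencePowerToY hV.isSubvariety.1 n).left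
    (specializes_iff_mem_closure.2 ht') h]

/-- The restricted projection is closed, surjective and has no specializations inside its fibres, so
the two dimension comparisons for closed maps apply. -/
theorem topologicalKrullDim_projY_image {C : Set (ambient Y E n).left} (hC : IsClosed C)
    (hCV : C ⊆ powerSet V n) :
    topologicalKrullDim (projY Y E n '' C) = topologicalKrullDim C := by
  have hcont : Continuous (projY Y E n) := Scheme.Hom.continuous _
  let φ : C → projY Y E n '' C := Set.MapsTo.restrict (projY Y E n) C _ (Set.mapsTo_image _ _)
  have hφ : Continuous φ := hcont.restrict (Set.mapsTo_image _ _)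
  have hφc : IsClosedMap φ := by
    intro K hK
    have hK' : IsClosed (Subtype.val '' K : Set (ambient Y E n).left) :=
      hC.isClosedMap_subtype_val _ hK
    have := isClosed_projY_image hE hV n hK' ((Subtype.coe_image_subset C K).trans hCV)
    have heq : φ '' K = Subtype.val ⁻¹' (projY Y E n '' (Subtype.val '' K)) := by
      ext ⟨y, hy⟩
      constructor
      · rintro ⟨c, hc, h⟩
        exact ⟨c, ⟨c, hc, rfl⟩, congrArg Subtype.val h⟩
      · rintro ⟨_, ⟨c, hc, rfl⟩, h⟩
        exact ⟨c, hc, Subtype.ext h⟩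
    rw [heq]
    exact this.preimage continuous_subtype_val
  have hφs : Function.Surjective φ := by
    rintro ⟨_, c, hc, rfl⟩
    exact ⟨⟨c, hc⟩, rfl⟩
  have : QuasiSober C := hC.isClosedEmbedding_subtypeVal.quasiSober
  have : QuasiSober (projY Y E n '' C) :=
    (isClosed_projY_image hE hV n hC hCV).isClosedEmbedding_subtypeVal.quasiSober
  refine le_antisymm (topologicalKrullDim_le_of_surjective hφ hφc hφs)
    (topologicalKrullDim_le_of_specializes_eq hφ hφc fun p q hpq h => Subtype.ext ?_)
  exact eq_of_specializes_of_projY_eq hE hV n (hCV p.2)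
    (Topology.IsInducing.subtypeVal.specializes_iff.2 hpq) (congrArg Subtype.val h)

end SpecialGraphs
end

/-! ### Special hulls, defects and optimality. -/

noncomputable section
namespace SpecialGraphs

theorem dim_eq_of_topologicalKrullDim_eq {X : Type} [TopologicalSpace X] {A : Set X} {d : ℕ}
    (h : topologicalKrullDim A = d) : dim A = d := by
  rw [dim, h]
  rfl

theorem isSpecialY_univ (Y : ShimuraCurve) (n : ℕ) :
    IsSpecialY Y n (Set.univ : Set (power Y.curve n).left) := by
  have := (isIrreducibleVariety_power Y.isIrreducibleVariety n).irreducibleSpace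
  refine ⟨⟨isClosed_univ, IrreducibleSpace.isIrreducible_univ _⟩, n, fun i => .inr (i, 1),
    fun i => ⟨?_, ?_⟩, ?_⟩
  · simp
  · simp
  · refine (Set.eq_univ_of_forall fun _ => trivial).trans (Set.eq_univ_of_forall fun x => ?_).symm
    refine ⟨fun i => (Y.unif_surjective (x i)).choose, funext fun i => ?_⟩
    simpa [coordinate] using (Y.unif_surjective (x i)).choose_spec

theorem isSpecialE_univ {E : SchC} [GrpObj E] (hE : IsEllipticCurve E) (n : ℕ) :
    IsSpecialE E n (Set.univ : Set (power E n).left) := by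
  have := (isIrreducibleVariety_power hE.isIrreducibleVariety n).irreducibleSpace
  refine ⟨⟨isClosed_univ, IrreducibleSpace.isIrreducible_univ _⟩, ⊤, 1, IsOfFinOrder.one, ?_⟩
  ext x
  simp

variable {Y : ShimuraCurve} {E : SchC} {V : Set (Y.curve ⊗ E).left} [GrpObj E]

/-- The special hull of a subset is special and contains it. -/
theorem exists_specialHull_eq_prodSet (hE : IsEllipticCurve E) (n : ℕ)
    (Z : Set (ambient Y E n).left) :
    ∃ S B, IsSpecialY Y n S ∧ IsSpecialE E n B ∧ Z ⊆ prodSet S B ∧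
      specialHull Y E n Z = prodSet S B := by
  by_cases h : ∃ T, IsLeast {T | IsSpecial Y E n T ∧ Z ⊆ T} T
  · obtain ⟨⟨S, B, hS, hB, hT⟩, hZ⟩ := h.choose_spec.1
    exact ⟨S, B, hS, hB, hT ▸ hZ, by rw [specialHull, dif_pos h, hT]⟩
  -- The default value is the whole space, which is itself special, so the existence of a smallest
  -- special subvariety need not be proved.
  · refine ⟨Set.univ, Set.univ, isSpecialY_univ Y n, isSpecialE_univ hE n, ?_, ?_⟩
    · simp [prodSet]
    · rw [specialHull, dif_neg h]
      simp [prodSet]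

theorem specialHull_eq_of_isLeast {n : ℕ} {Z T : Set (ambient Y E n).left}
    (h : IsLeast {T | IsSpecial Y E n T ∧ Z ⊆ T} T) : specialHull Y E n Z = T := by
  have h' : ∃ T, IsLeast {T | IsSpecial Y E n T ∧ Z ⊆ T} T := ⟨T, h⟩
  rw [specialHull, dif_pos h']
  exact h'.choose_spec.unique h

theorem topologicalKrullDim_prodSet (hE : IsEllipticCurve E) {n : ℕ}
    {S : Set (power Y.curve n).left} {B : Set (power E n).left} (hS : IsSubvariety S)
    (hB : IsSubvariety B) : ∃ d e : ℕ, topologicalKrullDim S = d ∧ topologicalKrullDim B = e ∧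
      topologicalKrullDim (prodSet S B) = (d + e : ℕ) := by
  have h1 := isIrreducibleVariety_power Y.isIrreducibleVariety n
  have h2 := isIrreducibleVariety_power hE.isIrreducibleVariety n
  have := h1.2; have := h1.3; have := h2.2; have := h2.3
  exact topologicalKrullDim_prod hS.1 hB.1 hS.2.nonempty hB.2.nonempty

/-- Every exemplary special graph is an optimal subvariety. -/
theorem IsExemplary.isOptimal (hE : IsEllipticCurve E) (hV : IsCorrespondence Y E V) {n : ℕ}
    {W : Set (ambient Y E n).left} (hW : IsExemplary V n W) :
    IsOptimal Y E n (powerSet V n) W := by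
  obtain ⟨⟨S, B₀, hS, hB₀, hcomp, hWS, -⟩, B, ⟨⟨hB, hWB⟩, hleast⟩, hmax⟩ := hW
  obtain ⟨⟨hWsub, hWin⟩, -⟩ := hcomp
  have hWV : W ⊆ powerSet V n := hWin.trans Set.inter_subset_left
  refine ⟨hWsub, hWV, fun C hC hWC hCV hdef => ?_⟩
  -- A special product containing `W` has first factor containing the image `S` of `W`, and second
  -- factor containing `B` by minimality.
  have hullW : specialHull Y E n W = prodSet S B := by
    refine specialHull_eq_of_isLeast ⟨⟨⟨S, B, hS, hB, rfl⟩, fun w hw =>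
      ⟨hWS.subset ⟨w, hw, rfl⟩, hWB ⟨w, hw, rfl⟩⟩⟩, ?_⟩
    rintro _ ⟨⟨S', B', -, hB', rfl⟩, hW'⟩
    have hSS : S ⊆ S' := by
      rw [← hWS]
      rintro _ ⟨w, hw, rfl⟩
      exact (hW' hw).1
    have hBB : B ⊆ B' := hleast ⟨hB', by rintro _ ⟨w, hw, rfl⟩; exact (hW' hw).2⟩
    exact Set.inter_subset_inter (Set.preimage_mono hSS) (Set.preimage_mono hBB)
  obtain ⟨S', B', hS', hB', hC', hullC⟩ := exists_specialHull_eq_prodSet hE n C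
  obtain ⟨s, b, hs, hb, hsb⟩ := topologicalKrullDim_prodSet hE hS.1 hB.1
  obtain ⟨s', b', hs', hb', hsb'⟩ := topologicalKrullDim_prodSet hE hS'.1 hB'.1
  have hdimW : topologicalKrullDim W = s := by
    rw [← topologicalKrullDim_projY_image hE hV n hWsub.1 hWV, hWS, hs]
  have hCS : projY Y E n '' C ⊆ S' := by
    rintro _ ⟨c, hc, rfl⟩
    exact (hC' hc).1
  have hCB : projE Y E n '' C ⊆ B' := by
    rintro _ ⟨c, hc, rfl⟩
    exact (hC' hc).2
  have hdimle : ∀ C' : Set (ambient Y E n).left, IsSubvariety C' → C' ⊆ powerSet V n →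
      C' ⊆ prodSet S' B' → topologicalKrullDim C' ≤ s' := fun C' hC'' hCV' hCin => by
    rw [← topologicalKrullDim_projY_image hE hV n hC''.1 hCV', ← hs']
    exact topologicalKrullDim_mono (Set.image_subset_iff.2 fun c hc => (hCin hc).1)
  have hBB : B ⊆ B' := hleast ⟨hB', (Set.image_mono hWC).trans hCB⟩
  -- The dimension of `C` lies between `s` and `s'`, hence is finite.
  have hdimC : ∃ c : ℕ, topologicalKrullDim C = c := by
    have h1 := hdimle C hC hCV hC'
    have h2 : (s : WithBot ℕ∞) ≤ topologicalKrullDim C :=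
      hdimW ▸ topologicalKrullDim_mono hWC
    revert h1 h2
    generalize topologicalKrullDim C = x
    intro h1 h2
    induction x with
    | bot => exact absurd h2 (by simp)
    | coe x =>
      obtain ⟨c, rfl⟩ := ENat.ne_top_iff_exists.1 (ne_top_of_le_ne_top (ENat.natCast_ne_top s')
        (WithBot.coe_le_coe.1 h1))
      exact ⟨c, rfl⟩
  obtain ⟨c, hc⟩ := hdimC
  have hcs : c ≤ s' := by
    have := hdimle C hC hCV hC'
    rw [hc] at this
    exact_mod_cast this
  have hbb : b ≤ b' := by
    have := topologicalKrullDim_mono hBB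
    rw [hb, hb'] at this
    exact_mod_cast this
  -- The inequality becomes `s' + b' - c ≤ s + b - s`. With `c ≤ s'` and `b ≤ b'`, it forces `b =
  -- b'` and `c = s'`.
  rw [defect, defect, hullC, hullW, dim_eq_of_topologicalKrullDim_eq hsb,
    dim_eq_of_topologicalKrullDim_eq hsb', dim_eq_of_topologicalKrullDim_eq hc,
    dim_eq_of_topologicalKrullDim_eq hdimW] at hdef
  push_cast at hdef
  obtain rfl : b = b' := by omega
  obtain rfl : c = s' := by omega
  obtain rfl : B = B' :=
    eq_of_subset_of_topologicalKrullDim_le hB.1.1 hB'.1.2 hBB hb (hb'.trans hb.symm).le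
  have hCim := topologicalKrullDim_projY_image hE hV n hC.1 hCV
  have hcont : Continuous (projY Y E n) := Scheme.Hom.continuous _
  have hCS' : projY Y E n '' C = S' :=
    eq_of_subset_of_topologicalKrullDim_le (isClosed_projY_image hE hV n hC.1 hCV) hS'.1.2 hCS
      (hCim.trans hc) (by rw [hCim, hc, hs'])
  have hgraph : IsSpecialGraph V n C := by
    refine ⟨S', B, hS', hB, ⟨⟨hC, Set.subset_inter hCV hC'⟩, ?_⟩, hCS', hCB⟩
    -- No subvariety of `Vⁿ ∩ (S' × B)` has dimension above `s' = dim C`, so `C` is a component.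
    rintro C₁ ⟨hC₁, hC₁in⟩ hCC₁
    refine (eq_of_subset_of_topologicalKrullDim_le hC.1 hC₁.2 hCC₁ hc ?_).ge
    rw [hc]
    exact hdimle C₁ hC₁ (hC₁in.trans Set.inter_subset_left) (hC₁in.trans Set.inter_subset_right)
  by_contra hne
  exact hmax ⟨C, hgraph, hWC.ssubset_of_ne (Ne.symm hne), hCB⟩

end SpecialGraphs
end

theorem proposition2p2 (Y : SpecialGraphs.ShimuraCurve) (E : SpecialGraphs.SchC) [GrpObj E]
    (hE : SpecialGraphs.IsEllipticCurve E) (V : Set (Y.curve ⊗ E).left)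
    (hV : SpecialGraphs.IsCorrespondence Y E V) (n : ℕ) :
    (∀ W : Set (SpecialGraphs.ambient Y E n).left,
      SpecialGraphs.IsExemplary V n W →
        SpecialGraphs.IsOptimal Y E n (SpecialGraphs.powerSet V n) W) ∧
    (SpecialGraphs.ZilberPink Y E n →
      {W : Set (SpecialGraphs.ambient Y E n).left | SpecialGraphs.IsExemplary V n W}.Finite) :=
  ⟨fun _ hW => hW.isOptimal hE hV, fun hZP =>
    (hZP _ (SpecialGraphs.isSubvariety_powerSet hE hV n)).subset fun _ hW => hW.isOptimal hE hV⟩
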